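/- Let $S$ be a set and let $\mathcal F$ be a set of finite subsets of $S$ with $\emptyset\in\mathcal F$, with $\{s\}\in\mathcal F$ for every $s\in S$, and with $F\cup F'\in\mathcal F$ whenever $F,F'\in\mathcal F$ and $F\cap F'\neq\emptyset$. Call $C\subseteq S$ connected if any two elements of $C$ lie in a common $F\in\mathcal F$ with $F\subseteq C$. If $\mathcal C$ is the set of connected sets, then $(S,\mathcal C)$ is called a connectoid. For $S'\subseteq S$, the induced subconnectoid on $S'$ is $(S',\mathcal C\cap\mathcal P(S'))$, and the components of $S'$ are the maximal connected subsets of $S'$. A necklace is a connected set $N$ for which there are finite connected sets $(H_n)_{n\in\mathbb N}$ with $N=\bigcup_n H_n$ such that $H_i\cap H_j\neq\emptyset$ if and only if $|i-j|\le 1$. For a finite set $X\subseteq S$, the $X$-tail of a necklace $N$ is the component of $N\setminus X$ that contains all but finitely many elements of $N$. Two necklaces are equivalent if for every finite $X\subseteq S$ their $X$-tails are contained in the same component of $S\setminus X$. The equivalence classes of necklaces are the ends of $(S,\mathcal C)$, and $\Omega(S,\mathcal C)$ is the set of ends. For an end $\omega$, let $K(X,\omega)$ be the component of $S\setminus X$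 that contains the $X$-tails of all necklaces in $\omega$. The end space is $\Omega(S,\mathcal C)$ with the topology generated by the sets $\{\omega: K(X,\omega)=K\}$, for all finite $X\subseteq S$ and all components $K$ of $S\setminus X$. Lemma and corollary. Let $(S,\mathcal C)$ be a connectoid and let $\Gamma\subseteq\Omega(S,\mathcal C)$ be open. Then: (1) There is a maximal (with respect to inclusion) set $\mathcal N$ of pairwise disjoint necklaces each of which belongs to an end in $\Omega(S,\mathcal C)\setminus\Gamma$. (2) For every such maximal set $\mathcal N$, let $(S',\mathcal C')$ be the induced subconnectoid on $S':=S\setminus\bigcup\mathcal N$. Then every end $\omega'$ of $(S',\mathcal C')$ is contained, as a set of necklaces, in a unique end $\phi(\omega')$ of $(S,\mathcal C)$, this end lies in $\Gamma$, and $\phi$ is a homeomorphism from $\Omega(S',\mathcal C')$ onto $\Gamma$ (with the subspace topology). In particular, $\Gamma$ is homeomorphic to the end space of an induced subconnectoid. (3) $\Gamma$ is ultra-paracompact: for every cover of $\Gamma$ by open subsets of $\Gamma$ there is a partition of $\Gamma$ into (nonempty) open sets each of which is contained in a member of the cover. -/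

import Mathlib

universe u

/-- `𝓕` is a set of finite subsets of `S` which contains the empty set and all singletons and is
closed under unions of two intersecting members. -/
structure IsConnectivityFamily {α : Type u} (S : Set α) (𝓕 : Set (Set α)) : Prop where
  finite : ∀ F ∈ 𝓕, F.Finite
  subset : ∀ F ∈ 𝓕, F ⊆ S
  union_mem : ∀ F ∈ 𝓕, ∀ F' ∈ 𝓕, (F ∩ F').Nonempty → F ∪ F' ∈ 𝓕
  singleton_mem : ∀ s ∈ S, {s} ∈ 𝓕
  empty_mem : ∅ ∈ 𝓕

/-- The subsets of `S` that are connected with respect to `𝓕`: any two of their elements lie in a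
common member of `𝓕` inside the set. -/
def inducedConnectedSets {α : Type u} (S : Set α) (𝓕 : Set (Set α)) : Set (Set α) :=
  {C | C ⊆ S ∧ ∀ x ∈ C, ∀ y ∈ C, ∃ F ∈ 𝓕, F ⊆ C ∧ x ∈ F ∧ y ∈ F}

/-- A connectoid `(S, 𝒞)`: a ground set `S` together with the set `𝒞` of connected sets induced by
some family `𝓕` as above. -/
structure Connectoid (α : Type u) where
  /-- the ground set `S` -/
  ground : Set α
  /-- the set `𝒞` of connected sets -/
  conn : Set (Set α)
  induced : ∃ 𝓕 : Set (Set α),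
    IsConnectivityFamily ground 𝓕 ∧ conn = inducedConnectedSets ground 𝓕

namespace Connectoid

variable {α : Type u}

/-- The induced subconnectoid `(S', 𝒞 ∩ 𝒫(S'))` on a subset `S'` of the ground set. -/
def induce (M : Connectoid α) (S' : Set α) (hS' : S' ⊆ M.ground) : Connectoid α where
  ground := S'
  conn := M.conn ∩ 𝒫 S'
  induced := by
    obtain ⟨𝓕, h𝓕, hC⟩ := M.induced
    refine ⟨{F | F ∈ 𝓕 ∧ F ⊆ S'}, ⟨fun F hF => h𝓕.finite F hF.1, fun F hF => hF.2,
      fun F hF F' hF' h => ⟨h𝓕.union_mem F hF.1 F' hF'.1 h, Set.union_subset hF.2 hF'.2⟩,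
      fun s hs => ⟨h𝓕.singleton_mem s (hS' hs), Set.singleton_subset_iff.2 hs⟩,
      ⟨h𝓕.empty_mem, Set.empty_subset _⟩⟩, ?_⟩
    rw [hC]
    ext C
    constructor
    · rintro ⟨⟨-, h⟩, hCS'⟩
      refine ⟨hCS', fun x hx y hy => ?_⟩
      obtain ⟨F, hF, hFC, hxF, hyF⟩ := h x hx y hy
      exact ⟨F, ⟨hF, hFC.trans hCS'⟩, hFC, hxF, hyF⟩
    · rintro ⟨hCS', h⟩
      refine ⟨⟨hCS'.trans hS', fun x hx y hy => ?_⟩, hCS'⟩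
      obtain ⟨F, hF, hFC, hxF, hyF⟩ := h x hx y hy
      exact ⟨F, hF.1, hFC, hxF, hyF⟩

/-- `K` is a component of `A`, i.e. a maximal connected subset of `A`. -/
def IsComponent (M : Connectoid α) (A K : Set α) : Prop :=
  Maximal (fun C => C ∈ M.conn ∧ C ⊆ A) K

/-- `H` is a witness of `N`. -/
def IsWitness (M : Connectoid α) (N : Set α) (H : ℕ → Set α) : Prop :=
  (∀ n, (H n).Finite ∧ H n ∈ M.conn) ∧ N = (⋃ n, H n) ∧
    ∀ i j : ℕ, (H i ∩ H j).Nonempty ↔ |(i : ℤ) - (j : ℤ)| ≤ 1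

/-- `N` is a necklace: a connected set that has a witness. -/
def IsNecklace (M : Connectoid α) (N : Set α) : Prop :=
  N ∈ M.conn ∧ ∃ H : ℕ → Set α, M.IsWitness N H

/-- `T` is the `X`-tail of the necklace `N`: the component of `N \ X` that contains all but
finitely many elements of `N`. -/
def IsTail (M : Connectoid α) (X : Finset α) (N T : Set α) : Prop :=
  M.IsComponent (N \ (X : Set α)) T ∧ (N \ T).Finite

/-- Equivalence of necklaces: for every finite set `X` of elements of the ground set, the `X`-tails
of the two necklaces are contained in the same component of the complement of `X`. -/
def NecklaceEquiv (M : Connectoid α) (N N' : Set α) : Prop :=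
  ∀ X : Finset α, (X : Set α) ⊆ M.ground →
    ∃ T T' K : Set α, M.IsTail X N T ∧ M.IsTail X N' T' ∧
      M.IsComponent (M.ground \ (X : Set α)) K ∧ T ⊆ K ∧ T' ⊆ K

/-- The ends of `M` are the equivalence classes of necklaces. -/
@[ext]
structure End (M : Connectoid α) where
  /-- the set of necklaces that form the end -/
  necklaces : Set (Set α)
  isClass : ∃ N, M.IsNecklace N ∧ necklaces = {N' | M.IsNecklace N' ∧ M.NecklaceEquiv N N'}

/-- The relation `K(X, ω) = K`: the component `K` of the complement of `X` contains the `X`-tails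
of all necklaces in `ω`. -/
def IsEndComponent (M : Connectoid α) (X : Finset α) (ω : M.End) (K : Set α) : Prop :=
  M.IsComponent (M.ground \ (X : Set α)) K ∧
    ∀ N ∈ ω.necklaces, ∀ T, M.IsTail X N T → T ⊆ K

/-- The topology of the end space, generated by the sets `{ω | K(X, ω) = K}` for all finite sets
`X` of elements of the ground set and all components `K` of the complement of `X`. -/
instance (M : Connectoid α) : TopologicalSpace M.End :=
  TopologicalSpace.generateFrom
    {U | ∃ (X : Finset α) (K : Set α), (X : Set α) ⊆ M.ground ∧
      M.IsComponent (M.ground \ (X : Set α)) K ∧ U = {ω | M.IsEndComponent X ω K}}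

/-- `𝒩` is a set of pairwise disjoint necklaces, each of which belongs to an end in `Δ`. -/
def IsDisjointNecklaceFamily (M : Connectoid α) (Δ : Set M.End) (𝒩 : Set (Set α)) : Prop :=
  (∀ N ∈ 𝒩, ∃ ω ∈ Δ, N ∈ ω.necklaces) ∧ 𝒩.PairwiseDisjoint id

end Connectoid

/-- A topological space is ultra-paracompact if every open cover of it can be refined to a
partition into (nonempty) open sets. -/
def UltraParacompact (X : Type u) [TopologicalSpace X] : Prop :=
  ∀ 𝒰 : Set (Set X), (∀ U ∈ 𝒰, IsOpen U) → ⋃₀ 𝒰 = Set.univ →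
    ∃ 𝓟 : Set (Set X), Setoid.IsPartition 𝓟 ∧ (∀ P ∈ 𝓟, IsOpen P) ∧
      ∀ P ∈ 𝓟, ∃ U ∈ 𝒰, P ⊆ U

/-! For (1) and (2), Zorn gives a maximal family. An end in `Γ` has a component `K` of the
complement of a finite `X` such that all ends living in `K` lie in `Γ`. Each necklace of the family
then meets `K` in a finite set, and those meeting `K` also meet `X`, so by disjointness there are
finitely many. Deleting this finite trace leaves a neighbourhood inside `S'`
(`exists_component_disjoint`). Hence `φ` is injective, onto `Γ` and open. Maximality keeps its image
in `Γ`; continuity holds for every induced subconnectoid.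

For (3), the homeomorphism reduces `Γ` to a whole end space (`ultraParacompact_end`). Call a
component bad if its set of ends has no open partition refining the cover. A bad component contains
bad ones avoiding any given finite set, whereas every necklace has a neighbourhood containing no bad
set. Such a family is empty (`IsFinitelyPersistent.eq_empty`): a suitable countable set along a
decreasing sequence of bad sets contains a necklace, so finitely many points outside it separate it
from all bad sets; but every bad set comes with a finite set that cannot be separated in this way,
and the countable set can be built to contain these. -/

namespace Connectoid

variable {α : Type u} {M : Connectoid α}

/-! ### Connected sets and components -/

theorem subset_ground {C : Set α} (hC : C ∈ M.conn) : C ⊆ M.ground := by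
  obtain ⟨𝓕, -, h⟩ := M.induced
  rw [h] at hC
  exact hC.1

theorem exists_finite_conn {C : Set α} (hC : C ∈ M.conn) {x y : α} (hx : x ∈ C) (hy : y ∈ C) :
    ∃ F : Set α, F.Finite ∧ F ∈ M.conn ∧ F ⊆ C ∧ x ∈ F ∧ y ∈ F := by
  obtain ⟨𝓕, h𝓕, h⟩ := M.induced
  rw [h] at hC ⊢
  obtain ⟨F, hF, hFC, hxF, hyF⟩ := hC.2 x hx y hy
  exact ⟨F, h𝓕.finite F hF, ⟨h𝓕.subset F hF, fun a ha b hb => ⟨F, hF, le_rfl, ha, hb⟩⟩,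
    hFC, hxF, hyF⟩

theorem conn_of_forall {C : Set α} (hC : C ⊆ M.ground)
    (h : ∀ x ∈ C, ∀ y ∈ C, ∃ F ∈ M.conn, F ⊆ C ∧ x ∈ F ∧ y ∈ F) : C ∈ M.conn := by
  obtain ⟨𝓕, -, h'⟩ := M.induced
  rw [h'] at h ⊢
  refine ⟨hC, fun x hx y hy => ?_⟩
  obtain ⟨F, hF, hFC, hxF, hyF⟩ := h x hx y hy
  obtain ⟨F', hF', hFF', hx', hy'⟩ := hF.2 x hxF y hyF
  exact ⟨F', hF', hFF'.trans hFC, hx', hy'⟩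

theorem conn_union {A B : Set α} (hA : A ∈ M.conn) (hB : B ∈ M.conn) (h : (A ∩ B).Nonempty) :
    A ∪ B ∈ M.conn := by
  obtain ⟨𝓕, h𝓕, h'⟩ := M.induced
  rw [h'] at hA hB ⊢
  obtain ⟨z, hzA, hzB⟩ := h
  refine ⟨Set.union_subset hA.1 hB.1, ?_⟩
  have key : ∀ x ∈ A ∪ B, ∃ F ∈ 𝓕, F ⊆ A ∪ B ∧ x ∈ F ∧ z ∈ F := by
    rintro x (hx | hx)
    · obtain ⟨F, hF, hFC, h1, h2⟩ := hA.2 x hx z hzA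
      exact ⟨F, hF, hFC.trans Set.subset_union_left, h1, h2⟩
    · obtain ⟨F, hF, hFC, h1, h2⟩ := hB.2 x hx z hzB
      exact ⟨F, hF, hFC.trans Set.subset_union_right, h1, h2⟩
  intro x hx y hy
  obtain ⟨F, hF, hFC, h1, h2⟩ := key x hx
  obtain ⟨F', hF', hFC', h1', h2'⟩ := key y hy
  exact ⟨F ∪ F', h𝓕.union_mem F hF F' hF' ⟨z, h2, h2'⟩, Set.union_subset hFC hFC',
    Or.inl h1, Or.inr h1'⟩

theorem conn_singleton {x : α} (hx : x ∈ M.ground) : {x} ∈ M.conn := by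
  obtain ⟨𝓕, h𝓕, h'⟩ := M.induced
  rw [h']
  refine ⟨Set.singleton_subset_iff.2 hx, ?_⟩
  rintro a rfl b rfl
  exact ⟨{b}, h𝓕.singleton_mem _ hx, le_rfl, rfl, rfl⟩

/-- The union of all connected subsets of `A` through a fixed point of `C` is connected, so no
choice principle is needed. -/
theorem exists_isComponent {A C : Set α} (hC : C ∈ M.conn) (hCA : C ⊆ A) (hne : C.Nonempty) :
    ∃ K, M.IsComponent A K ∧ C ⊆ K := by
  obtain ⟨x, hx⟩ := hne
  let K : Set α := ⋃₀ {E | E ∈ M.conn ∧ E ⊆ A ∧ x ∈ E}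
  have hsub : ∀ E ∈ M.conn, E ⊆ A → x ∈ E → E ⊆ K := fun E h1 h2 h3 =>
    Set.subset_sUnion_of_mem ⟨h1, h2, h3⟩
  have hK : K ∈ M.conn := by
    refine conn_of_forall (Set.sUnion_subset fun E hE => subset_ground hE.1) ?_
    rintro a ⟨E, ⟨h1, h2, h3⟩, ha⟩ b ⟨E', ⟨h1', h2', h3'⟩, hb⟩
    have hu := conn_union h1 h1' ⟨x, h3, h3'⟩
    exact ⟨E ∪ E', hu, hsub _ hu (Set.union_subset h2 h2') (Or.inl h3), Or.inl ha, Or.inr hb⟩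
  refine ⟨K, ⟨⟨hK, Set.sUnion_subset fun E hE => hE.2.1⟩, ?_⟩, hsub C hC hCA hx⟩
  intro E hE hKE
  exact hsub E hE.1 hE.2 (hKE (hsub C hC hCA hx hx))

theorem IsComponent.conn {A K : Set α} (h : M.IsComponent A K) : K ∈ M.conn := h.prop.1

theorem IsComponent.subset {A K : Set α} (h : M.IsComponent A K) : K ⊆ A := h.prop.2

theorem IsComponent.subset_of_inter {A K C : Set α} (hK : M.IsComponent A K) (hC : C ∈ M.conn)
    (hCA : C ⊆ A) (h : (C ∩ K).Nonempty) : C ⊆ K :=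
  Set.subset_union_left.trans
    (hK.le_of_ge ⟨conn_union hC hK.conn h, Set.union_subset hCA hK.subset⟩ Set.subset_union_right)

theorem IsComponent.eq_of_inter {A K K' : Set α} (hK : M.IsComponent A K)
    (hK' : M.IsComponent A K') (h : (K ∩ K').Nonempty) : K = K' :=
  (hK'.subset_of_inter hK.conn hK.subset h).antisymm
    (hK.subset_of_inter hK'.conn hK'.subset (Set.inter_comm K K' ▸ h))

theorem conn_iUnion_of_consecutive {H : ℕ → Set α} (hH : ∀ n, H n ∈ M.conn)
    (h : ∀ n, (H n ∩ H (n + 1)).Nonempty) : (⋃ n, H n) ∈ M.conn := by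
  have key : ∀ n, ∃ C ∈ M.conn, C ⊆ (⋃ n, H n) ∧ H 0 ⊆ C ∧ H n ⊆ C := by
    intro n
    induction n with
    | zero => exact ⟨H 0, hH 0, Set.subset_iUnion H 0, le_rfl, le_rfl⟩
    | succ n ih =>
      obtain ⟨C, hC, hCH, h0, hn⟩ := ih
      refine ⟨C ∪ H (n + 1), conn_union hC (hH _) ((h n).mono (Set.inter_subset_inter_left _ hn)),
        Set.union_subset hCH (Set.subset_iUnion H _), h0.trans Set.subset_union_left,
        Set.subset_union_right⟩
  refine conn_of_forall (Set.iUnion_subset fun n => subset_ground (hH n)) ?_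
  intro x hx y hy
  obtain ⟨i, hi⟩ := Set.mem_iUnion.1 hx
  obtain ⟨j, hj⟩ := Set.mem_iUnion.1 hy
  obtain ⟨C, hC, hCH, h0, hn⟩ := key i
  obtain ⟨C', hC', hCH', h0', hn'⟩ := key j
  obtain ⟨z, hz, -⟩ := h 0
  exact ⟨C ∪ C', conn_union hC hC' ⟨z, h0 hz, h0' hz⟩, Set.union_subset hCH hCH',
    Or.inl (hn hi), Or.inr (hn' hj)⟩

/-! ### Necklaces and their tails -/

theorem isNecklace_iUnion {H : ℕ → Set α} (hfin : ∀ n, (H n).Finite) (hH : ∀ n, H n ∈ M.conn)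
    (h : ∀ n, (H n ∩ H (n + 1)).Nonempty) (hd : ∀ i j, i + 2 ≤ j → Disjoint (H i) (H j)) :
    M.IsNecklace (⋃ n, H n) := by
  refine ⟨conn_iUnion_of_consecutive hH h, H, fun n => ⟨hfin n, hH n⟩, rfl, fun i j => ?_⟩
  constructor
  · intro hij
    by_contra hlt
    have hlt' : i + 2 ≤ j ∨ j + 2 ≤ i := by
      rw [abs_le] at hlt
      omega
    rcases hlt' with h' | h'
    · exact (Set.not_disjoint_iff_nonempty_inter.2 hij) (hd i j h')
    · exact (Set.not_disjoint_iff_nonempty_inter.2 hij) (hd j i h').symm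
  · intro hij
    have : i = j ∨ j = i + 1 ∨ i = j + 1 := by
      rw [abs_le] at hij
      omega
    rcases this with rfl | rfl | rfl
    · rw [Set.inter_self]
      exact (h i).mono Set.inter_subset_left
    · exact h i
    · rw [Set.inter_comm]
      exact h j

theorem IsWitness.disjoint {N : Set α} {H : ℕ → Set α} (hH : M.IsWitness N H) {i j : ℕ}
    (hij : i + 2 ≤ j) : Disjoint (H i) (H j) := by
  rw [Set.disjoint_iff_inter_eq_empty, ← Set.not_nonempty_iff_eq_empty, hH.2.2, abs_le]
  omega

theorem IsWitness.nonempty {N : Set α} {H : ℕ → Set α} (hH : M.IsWitness N H) (n : ℕ) :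
    (H n).Nonempty := by
  have := (hH.2.2 n n).2 (by simp)
  rwa [Set.inter_self] at this

theorem IsWitness.inter_succ {N : Set α} {H : ℕ → Set α} (hH : M.IsWitness N H) (n : ℕ) :
    (H n ∩ H (n + 1)).Nonempty := (hH.2.2 n (n + 1)).2 (by simp)

theorem IsNecklace.infinite {N : Set α} (hN : M.IsNecklace N) : N.Infinite := by
  obtain ⟨-, H, hH⟩ := hN
  choose x hx using hH.nonempty
  -- Only even indices: consecutive beads intersect, beads at distance two are disjoint.
  refine Set.infinite_of_injective_forall_mem (f := fun n : ℕ => x (2 * n)) ?_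
    (fun n => by rw [hH.2.1]; exact Set.mem_iUnion.2 ⟨_, hx _⟩)
  intro i j hij
  by_contra hne
  rcases lt_or_gt_of_ne hne with h | h
  · exact Set.disjoint_left.1 (hH.disjoint (show 2 * i + 2 ≤ 2 * j by omega)) (hx _)
      ((show x (2 * i) = x (2 * j) from hij) ▸ hx (2 * j))
  · exact Set.disjoint_left.1 (hH.disjoint (show 2 * j + 2 ≤ 2 * i by omega)) (hx _)
      ((show x (2 * j) = x (2 * i) from hij.symm) ▸ hx (2 * i))

/-- Every necklace contains a necklace that avoids a given finite set and almost equals it. -/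
theorem IsNecklace.exists_necklace_diff {N X : Set α} (hN : M.IsNecklace N) (hX : X.Finite) :
    ∃ T, M.IsNecklace T ∧ T ⊆ N \ X ∧ (N \ T).Finite := by
  obtain ⟨-, H, hH⟩ := hN
  have hbd : ∃ n₀, ∀ n ≥ n₀, Disjoint (H n) X := by
    induction X, hX using Set.Finite.induction_on with
    | empty => exact ⟨0, by simp⟩
    | @insert x X _ _ ih =>
      obtain ⟨n₀, h₀⟩ := ih
      have : ∃ n₁, ∀ n ≥ n₁, x ∉ H n := by
        by_cases hx : ∃ i, x ∈ H i
        · obtain ⟨i, hi⟩ := hx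
          exact ⟨i + 2, fun n hn => Set.disjoint_left.1 (hH.disjoint hn) hi⟩
        · exact ⟨0, fun n _ h => hx ⟨n, h⟩⟩
      obtain ⟨n₁, h₁⟩ := this
      refine ⟨max n₀ n₁, fun n hn => ?_⟩
      rw [Set.disjoint_insert_right]
      exact ⟨h₁ n (le_of_max_le_right hn), h₀ n (le_of_max_le_left hn)⟩
  obtain ⟨n₀, h₀⟩ := hbd
  refine ⟨⋃ n, H (n + n₀), isNecklace_iUnion (fun n => (hH.1 _).1) (fun n => (hH.1 _).2)
    (fun n => ?_) (fun i j hij => hH.disjoint (by omega)), ?_, ?_⟩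
  · rw [show n + 1 + n₀ = n + n₀ + 1 by omega]
    exact hH.inter_succ _
  · refine Set.iUnion_subset fun n x hx => ⟨?_, Set.disjoint_left.1 (h₀ _ (by omega)) hx⟩
    rw [hH.2.1]
    exact Set.mem_iUnion.2 ⟨_, hx⟩
  · refine ((Set.finite_lt_nat n₀).biUnion fun n _ => (hH.1 n).1).subset ?_
    rintro x ⟨hx, hx'⟩
    rw [hH.2.1] at hx
    obtain ⟨i, hi⟩ := Set.mem_iUnion.1 hx
    refine Set.mem_biUnion (show i < n₀ from ?_) hi
    by_contra hlt
    exact hx' (Set.mem_iUnion.2 ⟨i - n₀, by rwa [Nat.sub_add_cancel (not_lt.1 hlt)]⟩)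

/-- Used throughout to see that two connected sets containing almost all of a necklace intersect;
with `A = B` it yields a point of `A`. -/
theorem _root_.Set.Infinite.inter_nonempty_of_finite_diff {N A B : Set α} (hN : N.Infinite)
    (hA : (N \ A).Finite) (hB : (N \ B).Finite) : (N ∩ (A ∩ B)).Nonempty := by
  obtain ⟨x, hx, hx'⟩ := (hN.sdiff (hA.union hB)).nonempty
  by_contra hne
  exact hne ⟨x, hx, by_contra fun h => hx' (Or.inl ⟨hx, h⟩), by_contra fun h => hx' (Or.inr ⟨hx, h⟩)⟩

theorem IsNecklace.subset_ground {N : Set α} (hN : M.IsNecklace N) : N ⊆ M.ground :=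
  Connectoid.subset_ground hN.1

/-- For each finite set `X`, some component of its complement contains almost all of a necklace. -/
theorem IsNecklace.exists_component {N : Set α} (hN : M.IsNecklace N) {X : Set α}
    (hX : X.Finite) : ∃ K, M.IsComponent (M.ground \ X) K ∧ (N \ K).Finite := by
  obtain ⟨T, hT, hTN, hfin⟩ := hN.exists_necklace_diff hX
  obtain ⟨K, hK, hTK⟩ := exists_isComponent hT.1
    (hTN.trans (Set.sdiff_subset_sdiff_left hN.subset_ground)) hT.infinite.nonempty
  exact ⟨K, hK, hfin.subset (Set.sdiff_subset_sdiff_right hTK)⟩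

theorem IsNecklace.exists_isTail {N : Set α} (hN : M.IsNecklace N) (X : Finset α) :
    ∃ T, M.IsTail X N T := by
  obtain ⟨T, hT, hTN, hfin⟩ := hN.exists_necklace_diff X.finite_toSet
  obtain ⟨K, hK, hTK⟩ := exists_isComponent hT.1 hTN hT.infinite.nonempty
  exact ⟨K, hK, hfin.subset (Set.sdiff_subset_sdiff_right hTK)⟩

/-- Tails can thus be replaced by the condition that `K` contains almost all of `N`. -/
theorem IsTail.subset_iff {N T K : Set α} {X : Finset α} (hN : M.IsNecklace N)
    (hT : M.IsTail X N T) (hK : M.IsComponent (M.ground \ X) K) : T ⊆ K ↔ (N \ K).Finite := by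
  refine ⟨fun h => hT.2.subset (Set.sdiff_subset_sdiff_right h), fun h => ?_⟩
  obtain ⟨x, -, h1, h2⟩ := hN.infinite.inter_nonempty_of_finite_diff hT.2 h
  exact hK.subset_of_inter hT.1.conn
    (hT.1.subset.trans (Set.sdiff_subset_sdiff_left hN.subset_ground)) ⟨x, h1, h2⟩

theorem IsNecklace.component_unique {N A K K' : Set α} (hN : M.IsNecklace N)
    (hK : M.IsComponent A K) (hK' : M.IsComponent A K')
    (h : (N \ K).Finite) (h' : (N \ K').Finite) : K = K' := by
  obtain ⟨x, -, hx⟩ := hN.infinite.inter_nonempty_of_finite_diff h h'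
  exact hK.eq_of_inter hK' ⟨x, hx⟩

/-! ### Equivalence of necklaces, ends and the topology -/

theorem necklaceEquiv_iff {N N' : Set α} (hN : M.IsNecklace N) (hN' : M.IsNecklace N') :
    M.NecklaceEquiv N N' ↔ ∀ X : Finset α, (X : Set α) ⊆ M.ground →
      ∃ K, M.IsComponent (M.ground \ X) K ∧ (N \ K).Finite ∧ (N' \ K).Finite := by
  refine forall_congr' fun X => imp_congr_right fun _ => ⟨?_, ?_⟩
  · rintro ⟨T, T', K, hT, hT', hK, h, h'⟩
    exact ⟨K, hK, (hT.subset_iff hN hK).1 h, (hT'.subset_iff hN' hK).1 h'⟩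
  · rintro ⟨K, hK, h, h'⟩
    obtain ⟨T, hT⟩ := hN.exists_isTail X
    obtain ⟨T', hT'⟩ := hN'.exists_isTail X
    exact ⟨T, T', K, hT, hT', hK, (hT.subset_iff hN hK).2 h, (hT'.subset_iff hN' hK).2 h'⟩

theorem necklaceEquiv_of_finite_diff {N N' : Set α} (hN : M.IsNecklace N) (hN' : M.IsNecklace N')
    (h : (N' \ N).Finite) : M.NecklaceEquiv N N' := by
  rw [necklaceEquiv_iff hN hN']
  intro X _
  obtain ⟨K, hK, hfin⟩ := hN.exists_component X.finite_toSet
  refine ⟨K, hK, hfin, (h.union hfin).subset ?_⟩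
  rintro x ⟨hx, hxK⟩
  by_cases hxN : x ∈ N
  · exact Or.inr ⟨hxN, hxK⟩
  · exact Or.inl ⟨hx, hxN⟩

theorem NecklaceEquiv.symm {N N' : Set α} (h : M.NecklaceEquiv N N') : M.NecklaceEquiv N' N := by
  intro X hX
  obtain ⟨T, T', K, h1, h2, h3, h4, h5⟩ := h X hX
  exact ⟨T', T, K, h2, h1, h3, h5, h4⟩

theorem NecklaceEquiv.trans {N₁ N₂ N₃ : Set α} (hN₁ : M.IsNecklace N₁) (hN₂ : M.IsNecklace N₂)
    (hN₃ : M.IsNecklace N₃) (h : M.NecklaceEquiv N₁ N₂) (h' : M.NecklaceEquiv N₂ N₃) :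
    M.NecklaceEquiv N₁ N₃ := by
  rw [necklaceEquiv_iff ‹_› ‹_›] at *
  intro X hX
  obtain ⟨K, hK, h1, h2⟩ := h X hX
  obtain ⟨K', hK', h1', h2'⟩ := h' X hX
  obtain rfl := hN₂.component_unique hK hK' h2 h1'
  exact ⟨K, hK, h1, h2'⟩

/-- The end that contains a given necklace. -/
def endOf (M : Connectoid α) (N : Set α) (hN : M.IsNecklace N) : M.End where
  necklaces := {N' | M.IsNecklace N' ∧ M.NecklaceEquiv N N'}
  isClass := ⟨N, hN, rfl⟩

theorem mem_endOf {N : Set α} (hN : M.IsNecklace N) : N ∈ (M.endOf N hN).necklaces :=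
  ⟨hN, necklaceEquiv_of_finite_diff hN hN (by simp)⟩

theorem End.isNecklace {ω : M.End} {N : Set α} (h : N ∈ ω.necklaces) : M.IsNecklace N := by
  obtain ⟨N₀, -, h'⟩ := ω.isClass
  rw [h'] at h
  exact h.1

theorem End.nonempty (ω : M.End) : ∃ N, N ∈ ω.necklaces := by
  obtain ⟨N₀, hN₀, h'⟩ := ω.isClass
  exact ⟨N₀, h' ▸ mem_endOf hN₀⟩

theorem End.mem_iff {ω : M.End} {N N' : Set α} (h : N ∈ ω.necklaces) :
    N' ∈ ω.necklaces ↔ M.IsNecklace N' ∧ M.NecklaceEquiv N N' := by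
  obtain ⟨N₀, hN₀, h'⟩ := ω.isClass
  rw [h'] at h ⊢
  refine and_congr_right fun hN' => ⟨fun h2 => ?_, fun h2 => ?_⟩
  · exact NecklaceEquiv.trans h.1 hN₀ hN' h.2.symm h2
  · exact NecklaceEquiv.trans hN₀ h.1 hN' h.2 h2

theorem End.eq_of_mem {ω ω' : M.End} {N : Set α} (h : N ∈ ω.necklaces) (h' : N ∈ ω'.necklaces) :
    ω = ω' := by
  ext N'
  rw [End.mem_iff h, End.mem_iff h']

/-- One representative decides: equivalent necklaces have almost all their elements in the same
component. -/
theorem isEndComponent_iff {X : Finset α} {ω : M.End} {K N : Set α} (hX : (X : Set α) ⊆ M.ground)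
    (hN : N ∈ ω.necklaces) :
    M.IsEndComponent X ω K ↔ M.IsComponent (M.ground \ X) K ∧ (N \ K).Finite := by
  refine and_congr_right fun hK => ⟨fun h => ?_, fun h N' hN' T hT => ?_⟩
  · obtain ⟨T, hT⟩ := (End.isNecklace hN).exists_isTail X
    exact (hT.subset_iff (End.isNecklace hN) hK).1 (h N hN T hT)
  · have hN'' := (End.mem_iff hN).1 hN'
    rw [necklaceEquiv_iff (End.isNecklace hN) hN''.1] at hN''
    obtain ⟨K', hK', h1, h2⟩ := hN''.2 X hX
    obtain rfl := (End.isNecklace hN).component_unique hK hK' h h1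
    exact (hT.subset_iff hN''.1 hK).2 h2

theorem exists_isEndComponent {X : Finset α} (hX : (X : Set α) ⊆ M.ground) (ω : M.End) :
    ∃ K, M.IsEndComponent X ω K := by
  obtain ⟨N, hN⟩ := ω.nonempty
  obtain ⟨K, hK⟩ := (End.isNecklace hN).exists_component X.finite_toSet
  exact ⟨K, (isEndComponent_iff hX hN).2 hK⟩

theorem isOpen_isEndComponent {X : Finset α} (hX : (X : Set α) ⊆ M.ground) {K : Set α}
    (hK : M.IsComponent (M.ground \ X) K) : IsOpen {ω : M.End | M.IsEndComponent X ω K} :=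
  TopologicalSpace.isOpen_generateFrom_of_mem ⟨X, K, hX, hK, rfl⟩

theorem IsEndComponent.subset_of_subset {X Y : Finset α} {ω : M.End} {K L : Set α}
    (hY : (Y : Set α) ⊆ M.ground) (hXY : X ⊆ Y)
    (hK : M.IsEndComponent X ω K) (hL : M.IsEndComponent Y ω L) : L ⊆ K := by
  obtain ⟨N, hN⟩ := ω.nonempty
  have hX : (X : Set α) ⊆ M.ground := (Finset.coe_subset.2 hXY).trans hY
  rw [isEndComponent_iff hX hN] at hK
  rw [isEndComponent_iff hY hN] at hL
  obtain ⟨x, -, h1, h2⟩ := (End.isNecklace hN).infinite.inter_nonempty_of_finite_diff hK.2 hL.2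
  exact hK.1.subset_of_inter hL.1.conn
    (hL.1.subset.trans (Set.sdiff_subset_sdiff_right (Finset.coe_subset.2 hXY))) ⟨x, h2, h1⟩

theorem IsEndComponent.of_subset {X Y : Finset α} {ω : M.End} {K L : Set α}
    (hX : (X : Set α) ⊆ M.ground) (hY : (Y : Set α) ⊆ M.ground)
    (hK : M.IsComponent (M.ground \ X) K) (hLK : L ⊆ K) (hL : M.IsEndComponent Y ω L) :
    M.IsEndComponent X ω K := by
  obtain ⟨N, hN⟩ := ω.nonempty
  rw [isEndComponent_iff hY hN] at hL
  exact (isEndComponent_iff hX hN).2 ⟨hK, hL.2.subset (Set.sdiff_subset_sdiff_right hLK)⟩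

/-- The sets `{ω | K(X, ω) = K}` form a basis of the end space. -/
theorem exists_basic_subset {U : Set M.End} (hU : IsOpen U) {ω : M.End} (hω : ω ∈ U) :
    ∃ (X : Finset α) (K : Set α), (X : Set α) ⊆ M.ground ∧ M.IsEndComponent X ω K ∧
      {η | M.IsEndComponent X η K} ⊆ U := by
  classical
  induction hU with
  | basic V hV =>
    obtain ⟨X, K, hX, -, rfl⟩ := hV
    exact ⟨X, K, hX, hω, le_rfl⟩
  | univ =>
    obtain ⟨K, hK⟩ := exists_isEndComponent (X := ∅) (by simp) ω
    exact ⟨∅, K, by simp, hK, Set.subset_univ _⟩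
  | inter V W _ _ ihV ihW =>
    obtain ⟨X, K, hX, hK, hV⟩ := ihV hω.1
    obtain ⟨Y, L, hY, hL, hW⟩ := ihW hω.2
    have hXY : ((X ∪ Y : Finset α) : Set α) ⊆ M.ground := by
      rw [Finset.coe_union]
      exact Set.union_subset hX hY
    obtain ⟨J, hJ⟩ := exists_isEndComponent hXY ω
    refine ⟨X ∪ Y, J, hXY, hJ, fun η hη => ⟨hV ?_, hW ?_⟩⟩
    · exact hη.of_subset hX hXY hK.1 (hK.subset_of_subset hXY Finset.subset_union_left hJ)
    · exact hη.of_subset hY hXY hL.1 (hL.subset_of_subset hXY Finset.subset_union_right hJ)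
  | sUnion 𝒱 _ ih =>
    obtain ⟨V, hV, hωV⟩ := hω
    obtain ⟨X, K, hX, hK, h⟩ := ih V hV hωV
    exact ⟨X, K, hX, hK, h.trans (Set.subset_sUnion_of_mem hV)⟩

/-! ### Constructing necklaces; finitely persistent families -/

/-- A decreasing sequence of nonempty connected sets with empty intersection contains a necklace
that converges along the sequence. -/
theorem exists_necklace_of_antitone {C : ℕ → Set α} (hC : ∀ n, C n ∈ M.conn) (hanti : Antitone C)
    (hne : ∀ n, (C n).Nonempty) (hinter : ∀ x, ∃ n, x ∉ C n) :
    ∃ N, M.IsNecklace N ∧ N ⊆ C 0 ∧ ∀ n, (N \ C n).Finite := by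
  choose c hc using hne
  have hF : ∀ a b, ∃ F : Set α, F.Finite ∧ F ∈ M.conn ∧ (a ≤ b → F ⊆ C a ∧ c a ∈ F ∧ c b ∈ F) := by
    intro a b
    by_cases hab : a ≤ b
    · obtain ⟨F, h1, h2, h3⟩ := exists_finite_conn (hC a) (hc a) (hanti hab (hc b))
      exact ⟨F, h1, h2, fun _ => h3⟩
    · exact ⟨{c a}, Set.finite_singleton _,
        conn_singleton (subset_ground (hC a) (hc a)), fun h => absurd h hab⟩
  choose F hFfin hFconn hF using hF
  have hout : ∀ A : Set α, A.Finite → ∃ n, Disjoint A (C n) := by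
    intro A hA
    induction A, hA using Set.Finite.induction_on with
    | empty => exact ⟨0, by simp⟩
    | @insert x A _ _ ih =>
      obtain ⟨n, hn⟩ := ih
      obtain ⟨m, hm⟩ := hinter x
      refine ⟨max n m, Set.disjoint_insert_left.2 ⟨fun h => hm (hanti (le_max_right n m) h), ?_⟩⟩
      exact hn.mono_right (hanti (le_max_left n m))
  have hnext : ∀ a b, ∃ d, b < d ∧ Disjoint (F a b) (C d) := by
    intro a b
    obtain ⟨d, hd⟩ := hout (F a b) (hFfin a b)
    exact ⟨max d (b + 1), by omega, hd.mono_right (hanti (le_max_left _ _))⟩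
  choose next hlt hdisj using hnext
  -- Pairs of consecutive indices are carried along because `g (n + 2)` must be so large that `C (g
  -- (n + 2))` misses the bead joining `c (g n)` to `c (g (n + 1))`.
  let s : ℕ → ℕ × ℕ := fun n => Nat.rec (0, 1) (fun _ p => (p.2, next p.1 p.2)) n
  let g : ℕ → ℕ := fun n => (s n).1
  have hg : ∀ n, g (n + 2) = next (g n) (g (n + 1)) := fun n => rfl
  have hmono : StrictMono g := by
    refine strictMono_nat_of_lt_succ fun n => ?_
    cases n with
    | zero => exact Nat.zero_lt_one
    | succ n =>
      rw [show n + 1 + 1 = n + 2 from rfl, hg]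
      exact hlt _ _
  let H : ℕ → Set α := fun n => F (g n) (g (n + 1))
  have hH : ∀ n, H n ⊆ C (g n) ∧ c (g n) ∈ H n ∧ c (g (n + 1)) ∈ H n := fun n =>
    hF _ _ (hmono n.lt_succ_self).le
  refine ⟨⋃ n, H n, isNecklace_iUnion (fun n => hFfin _ _) (fun n => hFconn _ _)
    (fun n => ⟨_, (hH n).2.2, (hH (n + 1)).2.1⟩) ?_,
    Set.iUnion_subset fun n => (hH n).1.trans (hanti (Nat.zero_le _)), ?_⟩
  · intro i j hij
    have h1 : Disjoint (H i) (C (g (i + 2))) := hg i ▸ hdisj _ _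
    exact h1.mono_right ((hH j).1.trans (hanti (hmono.monotone hij)))
  · intro n
    refine ((Set.finite_lt_nat n).biUnion fun i _ => hFfin (g i) (g (i + 1))).subset ?_
    rintro x ⟨hx, hxn⟩
    obtain ⟨i, hi⟩ := Set.mem_iUnion.1 hx
    refine Set.mem_biUnion (show i < n from ?_) hi
    by_contra hlt
    exact hxn (hanti ((not_lt.1 hlt).trans (hmono.le_apply)) ((hH i).1 hi))

/-- A family of nonempty connected sets that is not exhausted by deleting finite sets. -/
structure IsFinitelyPersistent (M : Connectoid α) (𝓑 : Set (Set α)) : Prop where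
  conn : ∀ D ∈ 𝓑, D ∈ M.conn
  nonempty : ∀ D ∈ 𝓑, D.Nonempty
  exists_subset_diff : ∀ D ∈ 𝓑, ∀ Z : Set α, Z.Finite → ∃ E ∈ 𝓑, E ⊆ D \ Z

namespace IsFinitelyPersistent

variable {𝓑 : Set (Set α)}

/-- A decreasing sequence in the family together with a countable set `R` that meets each member in
a connected set, contains prescribed finite sets, and is eventually avoided pointwise. -/
theorem exists_antitone_seq (h𝓑 : M.IsFinitelyPersistent 𝓑) {D₀ : Set α} (hD₀ : D₀ ∈ 𝓑)
    (G : ℕ → Set α → Set α) (hG : ∀ n, ∀ D ∈ 𝓑, (G n D).Finite) :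
    ∃ (D : ℕ → Set α) (R : Set α), D 0 = D₀ ∧ Antitone D ∧ (∀ n, D n ∈ 𝓑) ∧
      (∀ n, R ∩ D n ∈ M.conn) ∧ (∀ x ∈ R, ∃ n, x ∉ D n) ∧ ∀ k n, G k (D n) ⊆ R := by
  have hF : ∀ (D : Set α) (x y : α), ∃ F : Set α, F.Finite ∧
      (D ∈ 𝓑 → x ∈ D → y ∈ D → F ∈ M.conn ∧ F ⊆ D ∧ x ∈ F ∧ y ∈ F) := by
    intro D x y
    by_cases h : D ∈ 𝓑 ∧ x ∈ D ∧ y ∈ D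
    · obtain ⟨F, h1, h2⟩ := exists_finite_conn (h𝓑.conn D h.1) h.2.1 h.2.2
      exact ⟨F, h1, fun _ _ _ => h2⟩
    · exact ⟨∅, Set.finite_empty, fun h1 h2 h3 => absurd ⟨h1, h2, h3⟩ h⟩
  choose F hFfin hF using hF
  -- A state holds the current member, all members so far, and the finite part of `R` built so far.
  -- Each step leaves that part behind, then enlarges it by the required sets `G` and by connecting
  -- sets in all earlier members.
  let σ := {p : Set α × Set (Set α) × Set α // p.1 ∈ 𝓑 ∧ p.2.1.Finite ∧ p.2.1 ⊆ 𝓑 ∧ p.2.2.Finite}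
  have step : ∀ (n : ℕ) (p : σ), ∃ q : σ, q.1.1 ⊆ p.1.1 \ p.1.2.2 ∧
      q.1.2.1 = insert q.1.1 p.1.2.1 ∧ p.1.2.2 ⊆ q.1.2.2 ∧
      (∀ D ∈ p.1.2.1, ∀ k ≤ n, G k D ⊆ q.1.2.2) ∧
      ∀ D ∈ p.1.2.1, ∀ x ∈ p.1.2.2, ∀ y ∈ p.1.2.2, F D x y ⊆ q.1.2.2 := by
    rintro n ⟨⟨D, 𝓓, P⟩, hD, h𝓓, h𝓓𝓑, hP⟩
    obtain ⟨E, hE, hED⟩ := h𝓑.exists_subset_diff D hD P hP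
    let Q : Set α := P ∪ ((⋃ D' ∈ 𝓓, ⋃ k ∈ {k | k ≤ n}, G k D') ∪
      ⋃ D' ∈ 𝓓, ⋃ x ∈ P, ⋃ y ∈ P, F D' x y)
    have hQ : Q.Finite := by
      refine hP.union ((h𝓓.biUnion fun D' hD' => (Set.finite_le_nat n).biUnion fun k _ =>
        hG k D' (h𝓓𝓑 hD')).union ?_)
      exact h𝓓.biUnion fun D' _ => hP.biUnion fun x _ => hP.biUnion fun y _ => hFfin _ _ _
    refine ⟨⟨⟨E, insert E 𝓓, Q⟩, hE, h𝓓.insert E, Set.insert_subset hE h𝓓𝓑, hQ⟩, hED, rfl,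
      Set.subset_union_left, ?_, ?_⟩
    · intro D' hD' k hk x hx
      refine Or.inr (Or.inl ?_)
      simp only [Set.mem_iUnion]
      exact ⟨D', hD', k, hk, hx⟩
    · intro D' hD' x hx y hy z hz
      refine Or.inr (Or.inr ?_)
      simp only [Set.mem_iUnion]
      exact ⟨D', hD', x, hx, y, hy, hz⟩
  choose next hsub hins hP hGs hFs using step
  let s : ℕ → σ := fun n => Nat.rec ⟨⟨D₀, {D₀}, ∅⟩, hD₀, Set.finite_singleton _,
    Set.singleton_subset_iff.2 hD₀, Set.finite_empty⟩ (fun n p => next n p) n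
  let D : ℕ → Set α := fun n => (s n).1.1
  let 𝓓 : ℕ → Set (Set α) := fun n => (s n).1.2.1
  let P : ℕ → Set α := fun n => (s n).1.2.2
  have hDP : ∀ n, D (n + 1) ⊆ D n \ P n := fun n => hsub n (s n)
  have hDanti : Antitone D := antitone_nat_of_succ_le fun n => (hDP n).trans Set.sdiff_subset
  have hPmono : Monotone P := monotone_nat_of_le_succ fun n => hP n (s n)
  have h𝓓succ : ∀ n, 𝓓 (n + 1) = insert (D (n + 1)) (𝓓 n) := fun n => hins n (s n)
  have h𝓓mono : Monotone 𝓓 := monotone_nat_of_le_succ fun n => by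
    rw [h𝓓succ]
    exact Set.subset_insert _ _
  have hmem : ∀ n, D n ∈ 𝓓 n := by
    intro n
    cases n with
    | zero => exact Set.mem_singleton _
    | succ n =>
      rw [h𝓓succ]
      exact Set.mem_insert _ _
  refine ⟨D, ⋃ n, P n, rfl, hDanti, fun n => (s n).2.1, fun n => ?_, fun x hx => ?_, ?_⟩
  · refine conn_of_forall (Set.inter_subset_right.trans
      (subset_ground (h𝓑.conn _ (s n).2.1))) ?_
    rintro x ⟨hx, hxD⟩ y ⟨hy, hyD⟩
    obtain ⟨i, hi⟩ := Set.mem_iUnion.1 hx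
    obtain ⟨j, hj⟩ := Set.mem_iUnion.1 hy
    obtain ⟨hF1, hF2, hF3⟩ := hF (D n) x y (s n).2.1 hxD hyD
    let m := max n (max i j)
    -- At stage `m` both points and `D n` are present, so their connecting set is added at stage `m
    -- + 1`.
    refine ⟨_, hF1, Set.subset_inter (Set.Subset.trans ?_ (Set.subset_iUnion P (m + 1))) hF2, hF3⟩
    exact hFs m (s m) (D n) (h𝓓mono (le_max_left _ _) (hmem n)) x
      (hPmono ((le_max_left i j).trans (le_max_right _ _)) hi) y
      (hPmono ((le_max_right i j).trans (le_max_right _ _)) hj)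
  · obtain ⟨i, hi⟩ := Set.mem_iUnion.1 hx
    exact ⟨i + 1, fun h => (hDP i h).2 hi⟩
  · intro k n
    let m := max k n
    refine Set.Subset.trans ?_ (Set.subset_iUnion P (m + 1))
    exact hGs m (s m) (D n) (h𝓓mono (le_max_right _ _) (hmem n)) k (le_max_left _ _)

/-- If the family is trivial near every necklace, then along a sequence as in `exists_antitone_seq`
the set `R` can be separated from the rest of the family by finitely many points outside `R`. -/
theorem exists_separator
    (hlocal : ∀ N, M.IsNecklace N → ∃ (X K : Set α), X.Finite ∧
      M.IsComponent (M.ground \ X) K ∧ (N \ K).Finite ∧ ∀ D ∈ 𝓑, ¬ D ⊆ K)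
    {D : ℕ → Set α} {R : Set α} (hanti : Antitone D)
    (hR : ∀ n, R ∩ D n ∈ M.conn) (hout : ∀ x ∈ R, ∃ n, x ∉ D n)
    (hne : ∀ n, (R ∩ D n).Nonempty) :
    ∃ (n : ℕ) (Z B : Set α), Z.Finite ∧ Z ⊆ D n \ R ∧ M.IsComponent (D n \ Z) B ∧
      R ∩ D n ⊆ B ∧ ∀ E ∈ 𝓑, ¬ E ⊆ B := by
  obtain ⟨N, hN, hN0, hNfin⟩ := exists_necklace_of_antitone hR
    (fun m n hmn => Set.inter_subset_inter_right R (hanti hmn)) hne (by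
      intro x
      by_cases hx : x ∈ R
      · obtain ⟨n, hn⟩ := hout x hx
        exact ⟨n, fun h => hn h.2⟩
      · exact ⟨0, fun h => hx h.1⟩)
  obtain ⟨X, K, hX, hK, hNK, hbad⟩ := hlocal N hN
  -- The finite set `X ∩ R` eventually leaves the sequence; from then on `X ∩ D n` is disjoint from
  -- `R` and serves as separator.
  have : ∃ n, ∀ x ∈ X ∩ R, x ∉ D n := by
    have hfin : (X ∩ R).Finite := hX.inter_of_left R
    choose! k hk using hout
    obtain ⟨n, hn⟩ := (hfin.image k).bddAbove
    exact ⟨n, fun x hx h => hk x hx.2 (hanti (hn (Set.mem_image_of_mem k hx)) h)⟩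
  obtain ⟨n, hn⟩ := this
  have hdisj : R ∩ D n ⊆ D n \ (X ∩ D n) := fun x hx => ⟨hx.2, fun h => hn x ⟨h.1, hx.1⟩ hx.2⟩
  obtain ⟨B, hB, hRB⟩ := exists_isComponent (hR n) hdisj (hne n)
  refine ⟨n, X ∩ D n, B, hX.inter_of_left _, fun x hx => ⟨hx.2, fun h => hn x ⟨hx.1, h⟩ hx.2⟩,
    hB, hRB, fun E hE hEB => hbad E hE (hEB.trans ?_)⟩
  obtain ⟨x, -, h1, h2⟩ := hN.infinite.inter_nonempty_of_finite_diff (hNfin n) hNK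
  refine hK.subset_of_inter hB.conn (fun y hy => ⟨subset_ground hB.conn hy, fun h => ?_⟩)
    ⟨x, hRB h1, h2⟩
  exact (hB.subset hy).2 ⟨h, (hB.subset hy).1⟩

/-- If the family is trivial near every necklace, then countable sets can be deleted. -/
theorem exists_subset_diff_iUnion (h𝓑 : M.IsFinitelyPersistent 𝓑)
    (hlocal : ∀ N, M.IsNecklace N → ∃ (X K : Set α), X.Finite ∧
      M.IsComponent (M.ground \ X) K ∧ (N \ K).Finite ∧ ∀ D ∈ 𝓑, ¬ D ⊆ K)
    {D₀ : Set α} (hD₀ : D₀ ∈ 𝓑) {Z : ℕ → Set α} (hZ : ∀ n, (Z n).Finite) :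
    ∃ E ∈ 𝓑, E ⊆ D₀ ∧ ∀ n, Disjoint E (Z n) := by
  obtain ⟨D, R, h0, hanti, hD, hR, hout, hG⟩ :=
    h𝓑.exists_antitone_seq hD₀ (fun n _ => Z n) (fun n _ _ => hZ n)
  have hDD₀ : ∀ n, D n ⊆ D₀ := fun n => h0 ▸ hanti (Nat.zero_le n)
  suffices h : ∃ E ∈ 𝓑, E ⊆ D₀ ∧ Disjoint E R by
    obtain ⟨E, hE, hE0, hER⟩ := h
    exact ⟨E, hE, hE0, fun n => hER.mono_right (hG n 0)⟩
  by_cases hne : ∀ n, (R ∩ D n).Nonempty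
  · obtain ⟨n, W, B, hW, hWD, hB, hRB, hbad⟩ :=
      exists_separator hlocal hanti hR hout hne
    obtain ⟨E, hE, hED⟩ := h𝓑.exists_subset_diff (D n) (hD n) W hW
    refine ⟨E, hE, (hED.trans Set.sdiff_subset).trans (hDD₀ n), Set.disjoint_left.2 ?_⟩
    -- A member avoiding `W` that met `R` would lie in `B`, which contains no member.
    intro x hx hxR
    exact hbad E hE (hB.subset_of_inter (h𝓑.conn E hE) hED ⟨x, hx, hRB ⟨hxR, (hED hx).1⟩⟩)
  · push Not at hne
    obtain ⟨n, hn⟩ := hne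
    exact ⟨D n, hD n, hDD₀ n, (Set.disjoint_iff_inter_eq_empty.2 hn).symm⟩

/-- Each member has a finite subset that cannot be separated from the rest of the family by
finitely many other points. -/
theorem exists_finite_inseparable (h𝓑 : M.IsFinitelyPersistent 𝓑)
    (hlocal : ∀ N, M.IsNecklace N → ∃ (X K : Set α), X.Finite ∧
      M.IsComponent (M.ground \ X) K ∧ (N \ K).Finite ∧ ∀ D ∈ 𝓑, ¬ D ⊆ K)
    {D : Set α} (hD : D ∈ 𝓑) :
    ∃ R : Set α, R.Finite ∧ ∀ Z B : Set α, Z.Finite → Disjoint Z R →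
      M.IsComponent (D \ Z) B → R ∩ D ⊆ B → ∃ E ∈ 𝓑, E ⊆ B := by
  by_contra! hcon
  obtain ⟨y, hy⟩ := h𝓑.nonempty D hD
  let σ := {R : Set α // R.Finite ∧ y ∈ R}
  have step : ∀ R : σ, ∃ Z : Set α, Z.Finite ∧ Disjoint Z R.1 ∧
      ∃ B, M.IsComponent (D \ Z) B ∧ y ∈ B ∧ ∀ E ∈ 𝓑, ¬ E ⊆ B := by
    rintro ⟨R, hR, hyR⟩
    obtain ⟨Z, B, hZ, hZR, hB, hRB, hbad⟩ := hcon R hR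
    exact ⟨Z, hZ, hZR, B, hB, hRB ⟨hyR, hy⟩, hbad⟩
  choose Z hZ hZR B hB hyB hbad using step
  -- Adding each separator to the next `R` makes the separators pairwise disjoint.
  let s : ℕ → σ := fun n => Nat.rec ⟨{y}, Set.finite_singleton y, rfl⟩
    (fun _ R => ⟨R.1 ∪ Z R, R.2.1.union (hZ R), Or.inl R.2.2⟩) n
  have hs : ∀ n, (s (n + 1)).1 = (s n).1 ∪ Z (s n) := fun n => rfl
  have hmono : Monotone fun n => (s n).1 := monotone_nat_of_le_succ fun n => by
    rw [hs]
    exact Set.subset_union_left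
  have hdisj : ∀ i j, i < j → Disjoint (Z (s j)) (Z (s i)) := fun i j hij =>
    (hZR (s j)).mono_right ((hs i ▸ Set.subset_union_right).trans (hmono (Nat.succ_le_of_lt hij)))
  obtain ⟨E, hE, hED, hEZ⟩ := h𝓑.exists_subset_diff_iUnion hlocal hD fun n => hZ (s n)
  obtain ⟨p, hp⟩ := h𝓑.nonempty E hE
  obtain ⟨F, hFfin, hF, hFD, hyF, hpF⟩ := exists_finite_conn (h𝓑.conn D hD) hy (hED hp)
  -- If `F` missed a separator, `F ∪ E` would connect `y` to `E` off it, putting `E` into `B (s n)`.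
  -- So the finite set `F` meets infinitely many disjoint sets.
  have hmeet : ∀ n, (F ∩ Z (s n)).Nonempty := by
    intro n
    by_contra hemp
    rw [Set.not_nonempty_iff_eq_empty, ← Set.disjoint_iff_inter_eq_empty] at hemp
    refine hbad (s n) E hE (Set.subset_union_right.trans
      ((hB (s n)).subset_of_inter (conn_union hF (h𝓑.conn E hE) ⟨p, hpF, hp⟩) ?_
        ⟨y, Or.inl hyF, hyB _⟩))
    exact Set.subset_sdiff.2 ⟨Set.union_subset hFD hED, Set.disjoint_union_left.2 ⟨hemp, hEZ n⟩⟩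
  choose f hf using hmeet
  refine Set.infinite_of_injective_forall_mem (f := f) ?_ (fun n => (hf n).1) hFfin
  intro i j hij
  by_contra hne
  rcases lt_or_gt_of_ne hne with h | h
  · exact Set.disjoint_left.1 (hdisj i j h) (hf j).2 (hij ▸ (hf i).2)
  · exact Set.disjoint_left.1 (hdisj j i h) (hf i).2 (hij ▸ (hf j).2)

/-- Feeding the inseparable finite sets into `exists_antitone_seq` makes the countable set contain
them all, so the separator from `exists_separator` contradicts inseparability for some `D n`. -/
theorem eq_empty (h𝓑 : M.IsFinitelyPersistent 𝓑)
    (hlocal : ∀ N, M.IsNecklace N → ∃ (X K : Set α), X.Finite ∧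
      M.IsComponent (M.ground \ X) K ∧ (N \ K).Finite ∧ ∀ D ∈ 𝓑, ¬ D ⊆ K) : 𝓑 = ∅ := by
  by_contra hne
  obtain ⟨D₀, hD₀⟩ := Set.nonempty_iff_ne_empty.2 hne
  have h1 : ∀ D, ∃ R : Set α, D ∈ 𝓑 → R.Finite ∧ (R ∩ D).Nonempty ∧ ∀ Z B : Set α, Z.Finite →
      Disjoint Z R → M.IsComponent (D \ Z) B → R ∩ D ⊆ B → ∃ E ∈ 𝓑, E ⊆ B := by
    intro D
    by_cases hD : D ∈ 𝓑
    · obtain ⟨R, hR, h⟩ := h𝓑.exists_finite_inseparable hlocal hD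
      obtain ⟨y, hy⟩ := h𝓑.nonempty D hD
      -- Enlarging `R` preserves inseparability; the point `y` ensures that it meets `D`.
      refine ⟨insert y R, fun _ => ⟨hR.insert y, ⟨y, Set.mem_insert _ _, hy⟩, ?_⟩⟩
      intro Z B hZ hZR hB hRB
      exact h Z B hZ (hZR.mono_right (Set.subset_insert _ _)) hB
        ((Set.inter_subset_inter_left D (Set.subset_insert _ _)).trans hRB)
    · exact ⟨∅, fun h => absurd h hD⟩
  choose R hR using h1
  obtain ⟨D, S, -, hanti, hD, hS, hout, hG⟩ :=
    h𝓑.exists_antitone_seq hD₀ (fun _ D => R D) (fun _ D hD => (hR D hD).1)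
  have hRS : ∀ n, R (D n) ⊆ S := hG 0
  obtain ⟨n, Z, B, hZ, hZD, hB, hSB, hbad⟩ := exists_separator hlocal hanti hS hout
    fun n => (hR _ (hD n)).2.1.mono (Set.inter_subset_inter_left _ (hRS n))
  obtain ⟨E, hE, hEB⟩ := (hR _ (hD n)).2.2 Z B hZ
    (Set.disjoint_left.2 fun x hx h => (hZD hx).2 (hRS n h)) hB
    ((Set.inter_subset_inter_left _ (hRS n)).trans hSB)
  exact hbad E hE hEB

end IsFinitelyPersistent

end Connectoid

/-! ### Open partitions -/

/-- `W` has a partition into nonempty open sets each of which lies in a member of `𝒰`. -/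
def HasOpenPartition {X : Type u} [TopologicalSpace X] (𝒰 : Set (Set X)) (W : Set X) : Prop :=
  ∃ 𝓟 : Set (Set X), 𝓟.PairwiseDisjoint id ∧ ⋃₀ 𝓟 = W ∧
    ∀ P ∈ 𝓟, IsOpen P ∧ P.Nonempty ∧ ∃ U ∈ 𝒰, P ⊆ U

theorem HasOpenPartition.of_subset {X : Type u} [TopologicalSpace X] {𝒰 : Set (Set X)}
    {W U : Set X} (hW : IsOpen W) (hU : U ∈ 𝒰) (hWU : W ⊆ U) : HasOpenPartition 𝒰 W := by
  rcases W.eq_empty_or_nonempty with rfl | hne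
  · exact ⟨∅, Set.pairwiseDisjoint_empty, Set.sUnion_empty, by simp⟩
  · exact ⟨{W}, Set.pairwiseDisjoint_singleton _ _, Set.sUnion_singleton _, by
      rintro P rfl
      exact ⟨hW, hne, U, hU, hWU⟩⟩

theorem HasOpenPartition.iUnion {X : Type u} [TopologicalSpace X] {𝒰 : Set (Set X)} {ι : Type*}
    {W : ι → Set X} (hW : ∀ i, HasOpenPartition 𝒰 (W i))
    (hd : ∀ i j, (W i ∩ W j).Nonempty → i = j) : HasOpenPartition 𝒰 (⋃ i, W i) := by
  choose 𝓟 hdisj hunion hP using hW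
  refine ⟨⋃ i, 𝓟 i, ?_, ?_, ?_⟩
  · intro P hPi Q hQj hPQ
    obtain ⟨i, hi⟩ := Set.mem_iUnion.1 hPi
    obtain ⟨j, hj⟩ := Set.mem_iUnion.1 hQj
    by_contra hcon
    obtain ⟨x, hx, hx'⟩ := Set.not_disjoint_iff.1 hcon
    obtain rfl := hd i j ⟨x, hunion i ▸ ⟨P, hi, hx⟩, hunion j ▸ ⟨Q, hj, hx'⟩⟩
    exact hcon (hdisj i hi hj hPQ)
  · rw [Set.sUnion_iUnion]
    exact Set.iUnion_congr hunion
  · intro P hPi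
    obtain ⟨i, hi⟩ := Set.mem_iUnion.1 hPi
    exact hP i P hi

theorem UltraParacompact.of_hasOpenPartition {X : Type u} [TopologicalSpace X]
    (h : ∀ 𝒰 : Set (Set X), (∀ U ∈ 𝒰, IsOpen U) → ⋃₀ 𝒰 = Set.univ →
      HasOpenPartition 𝒰 Set.univ) : UltraParacompact X := by
  intro 𝒰 hopen hcov
  obtain ⟨𝓟, hdisj, hunion, hP⟩ := h 𝒰 hopen hcov
  refine ⟨𝓟, ⟨fun h => Set.not_nonempty_empty (hP ∅ h).2.1, fun x => ?_⟩,
    fun P h => (hP P h).1, fun P h => (hP P h).2.2⟩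
  obtain ⟨P, hPm, hx⟩ : x ∈ ⋃₀ 𝓟 := hunion ▸ Set.mem_univ x
  refine ⟨P, ⟨hPm, hx⟩, fun Q hQ => ?_⟩
  exact hdisj.elim hQ.1 hPm (Set.not_disjoint_iff.2 ⟨x, hQ.2, hx⟩)

theorem UltraParacompact.of_homeomorph {X Y : Type u} [TopologicalSpace X] [TopologicalSpace Y]
    (e : X ≃ₜ Y) (h : UltraParacompact X) : UltraParacompact Y := by
  intro 𝒰 hopen hcov
  obtain ⟨𝓟, hpart, hP, hPU⟩ := h ((fun U => e ⁻¹' U) '' 𝒰)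
    (by rintro _ ⟨U, hU, rfl⟩; exact (hopen U hU).preimage e.continuous)
    (by
      refine Set.eq_univ_of_forall fun x => ?_
      obtain ⟨U, hU, hx⟩ : e x ∈ ⋃₀ 𝒰 := hcov ▸ Set.mem_univ _
      exact ⟨_, ⟨U, hU, rfl⟩, hx⟩)
  refine ⟨(fun P => e.symm ⁻¹' P) '' 𝓟, ⟨?_, fun y => ?_⟩, ?_, ?_⟩
  · rintro ⟨P, hPm, hPe⟩
    have hemp : P = ∅ := Set.eq_empty_of_forall_notMem fun x hx => by
      have hmem : e x ∈ e.symm ⁻¹' P := by simpa using hx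
      simp only [hPe] at hmem
      exact hmem
    exact hpart.1 (hemp ▸ hPm)
  · obtain ⟨P, ⟨hPm, hx⟩, huniq⟩ := hpart.2 (e.symm y)
    refine ⟨e.symm ⁻¹' P, ⟨⟨P, hPm, rfl⟩, hx⟩, ?_⟩
    rintro _ ⟨⟨Q, hQ, rfl⟩, hy⟩
    rw [huniq Q ⟨hQ, hy⟩]
  · rintro _ ⟨P, hPm, rfl⟩
    exact (hP P hPm).preimage e.symm.continuous
  · rintro _ ⟨P, hPm, rfl⟩
    obtain ⟨_, ⟨U, hU, rfl⟩, hsub⟩ := hPU P hPm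
    refine ⟨U, hU, fun y hy => ?_⟩
    have := hsub hy
    simpa using this

namespace Connectoid

variable {α : Type u} {M : Connectoid α}

/-! ### End spaces are ultra-paracompact -/

/-- The ends whose necklaces are almost contained in `D`. -/
def endsIn (M : Connectoid α) (D : Set α) : Set M.End :=
  {ω | ∃ N ∈ ω.necklaces, (N \ D).Finite}

theorem endsIn_eq {X : Finset α} (hX : (X : Set α) ⊆ M.ground) {K : Set α}
    (hK : M.IsComponent (M.ground \ X) K) : M.endsIn K = {ω | M.IsEndComponent X ω K} := by
  ext ω
  constructor
  · rintro ⟨N, hN, h⟩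
    exact (isEndComponent_iff hX hN).2 ⟨hK, h⟩
  · intro h
    obtain ⟨N, hN⟩ := ω.nonempty
    exact ⟨N, hN, ((isEndComponent_iff hX hN).1 h).2⟩

theorem endsIn_mono {D E : Set α} (h : D ⊆ E) : M.endsIn D ⊆ M.endsIn E := by
  rintro ω ⟨N, hN, hfin⟩
  exact ⟨N, hN, hfin.subset (Set.sdiff_subset_sdiff_right h)⟩

/-- Deleting more points splits the ends in `D` disjointly among the smaller components in `D`, so
their partitions combine. -/
theorem hasOpenPartition_endsIn {𝒰 : Set (Set M.End)} {X Y : Finset α}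
    (hY : (Y : Set α) ⊆ M.ground) (hXY : X ⊆ Y) {D : Set α}
    (hD : M.IsComponent (M.ground \ X) D)
    (h : ∀ E, M.IsComponent (M.ground \ Y) E → E ⊆ D → HasOpenPartition 𝒰 (M.endsIn E)) :
    HasOpenPartition 𝒰 (M.endsIn D) := by
  have hX : (X : Set α) ⊆ M.ground := (Finset.coe_subset.2 hXY).trans hY
  have hU := HasOpenPartition.iUnion (𝒰 := 𝒰)
    (W := fun E : {E // M.IsComponent (M.ground \ Y) E ∧ E ⊆ D} => M.endsIn E.1)
    (fun E => h E.1 E.2.1 E.2.2) (by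
      rintro ⟨E, hE, hED⟩ ⟨E', hE', hED'⟩ ⟨ω, hω, hω'⟩
      obtain ⟨N, hN⟩ := ω.nonempty
      rw [endsIn_eq hY hE] at hω
      rw [endsIn_eq hY hE'] at hω'
      exact Subtype.ext ((End.isNecklace hN).component_unique hE hE'
        ((isEndComponent_iff hY hN).1 hω).2 ((isEndComponent_iff hY hN).1 hω').2))
  convert hU using 1
  refine Set.Subset.antisymm (fun ω hω => ?_) (Set.iUnion_subset fun E => endsIn_mono E.2.2)
  rw [endsIn_eq hX hD] at hω
  obtain ⟨E, hE⟩ := exists_isEndComponent hY ω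
  refine Set.mem_iUnion.2 ⟨⟨E, hE.1, IsEndComponent.subset_of_subset hY hXY hω hE⟩, ?_⟩
  rw [endsIn_eq hY hE.1]
  exact hE

/-- End spaces of connectoids are ultra-paracompact. -/
theorem ultraParacompact_end (M : Connectoid α) : UltraParacompact M.End := by
  classical
  refine UltraParacompact.of_hasOpenPartition fun 𝒰 hopen hcov => ?_
  let 𝓑 : Set (Set α) := {D | (∃ X : Finset α, (X : Set α) ⊆ M.ground ∧
    M.IsComponent (M.ground \ X) D) ∧ ¬ HasOpenPartition 𝒰 (M.endsIn D)}
  have h𝓑 : M.IsFinitelyPersistent 𝓑 := by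
    refine ⟨fun D hD => hD.1.choose_spec.2.conn, fun D hD => ?_, ?_⟩
    · by_contra hne
      rw [Set.not_nonempty_iff_eq_empty] at hne
      refine hD.2 ⟨∅, Set.pairwiseDisjoint_empty, ?_, by simp⟩
      rw [Set.sUnion_empty, eq_comm, Set.eq_empty_iff_forall_notMem]
      rintro ω ⟨N, hN, hfin⟩
      rw [hne, Set.sdiff_empty] at hfin
      exact (End.isNecklace hN).infinite hfin
    · rintro D ⟨⟨X, hX, hDX⟩, hD⟩ Z hZ
      by_contra! hcon
      have hZ' : (Z ∩ M.ground).Finite := hZ.inter_of_left _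
      have hY : ((X ∪ hZ'.toFinset : Finset α) : Set α) ⊆ M.ground := by
        rw [Finset.coe_union, Set.Finite.coe_toFinset]
        exact Set.union_subset hX Set.inter_subset_right
      refine hD (hasOpenPartition_endsIn hY Finset.subset_union_left hDX fun E hE hED => ?_)
      by_contra hbad
      refine hcon E ⟨⟨_, hY, hE⟩, hbad⟩ fun x hx => ⟨hED hx, fun hxZ => (hE.subset hx).2 ?_⟩
      rw [Finset.coe_union, Set.Finite.coe_toFinset]
      exact Or.inr ⟨hxZ, subset_ground hE.conn hx⟩
  have hempty : 𝓑 = ∅ := by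
    -- A basic neighbourhood of the end of `N` inside a cover member makes every component within it
    -- good.
    refine h𝓑.eq_empty fun N hN => ?_
    obtain ⟨U, hU, hω⟩ : M.endOf N hN ∈ ⋃₀ 𝒰 := hcov ▸ Set.mem_univ _
    obtain ⟨X, K, hX, hK, hsub⟩ := exists_basic_subset (hopen U hU) hω
    refine ⟨X, K, X.finite_toSet, hK.1, ((isEndComponent_iff hX (mem_endOf hN)).1 hK).2, ?_⟩
    rintro D ⟨⟨Y, hY, hD⟩, hbad⟩ hDK
    refine hbad (HasOpenPartition.of_subset (U := U) ?_ hU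
      (((endsIn_mono hDK).trans (endsIn_eq hX hK.1).le).trans hsub))
    rw [endsIn_eq hY hD]
    exact isOpen_isEndComponent hY hD
  have hgood : ∀ E, M.IsComponent (M.ground \ (∅ : Finset α)) E →
      HasOpenPartition 𝒰 (M.endsIn E) := by
    intro E hE
    by_contra hbad
    have : E ∈ 𝓑 := ⟨⟨∅, by simp, hE⟩, hbad⟩
    simp [hempty] at this
  have hall := HasOpenPartition.iUnion (𝒰 := 𝒰)
    (W := fun E : {E // M.IsComponent (M.ground \ (∅ : Finset α)) E} => M.endsIn E.1)
    (fun E => hgood E.1 E.2) (by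
      rintro ⟨E, hE⟩ ⟨E', hE'⟩ ⟨ω, hω, hω'⟩
      obtain ⟨N, hN⟩ := ω.nonempty
      rw [endsIn_eq (by simp) hE] at hω
      rw [endsIn_eq (by simp) hE'] at hω'
      exact Subtype.ext ((End.isNecklace hN).component_unique hE hE'
        ((isEndComponent_iff (by simp) hN).1 hω).2 ((isEndComponent_iff (by simp) hN).1 hω').2))
  convert hall using 1
  refine (Set.eq_univ_of_forall fun ω => ?_).symm
  obtain ⟨E, hE⟩ := exists_isEndComponent (X := ∅) (by simp) ω
  refine Set.mem_iUnion.2 ⟨⟨E, hE.1⟩, ?_⟩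
  rw [endsIn_eq (by simp) hE.1]
  exact hE

/-! ### Ends of induced subconnectoids -/

section Induce

variable {S' : Set α} {hS' : S' ⊆ M.ground}

theorem isNecklace_induce {N : Set α} :
    (M.induce S' hS').IsNecklace N ↔ M.IsNecklace N ∧ N ⊆ S' := by
  constructor
  · rintro ⟨hN, H, hH, hNH, h⟩
    exact ⟨⟨hN.1, H, fun n => ⟨(hH n).1, (hH n).2.1⟩, hNH, h⟩, hN.2⟩
  · rintro ⟨⟨hN, H, hH, hNH, h⟩, hNS⟩
    refine ⟨⟨hN, hNS⟩, H, fun n => ⟨(hH n).1, (hH n).2, ?_⟩, hNH, h⟩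
    exact Set.Subset.trans (hNH ▸ Set.subset_iUnion H n) hNS

/-- A component of the subconnectoid lies in a component of the whole connectoid. -/
theorem exists_component_of_induce {X : Finset α} {N K' : Set α}
    (hN : (M.induce S' hS').IsNecklace N)
    (hK' : (M.induce S' hS').IsComponent (S' \ ((X : Set α) ∩ S')) K') (hfin : (N \ K').Finite) :
    ∃ K, M.IsComponent (M.ground \ X) K ∧ K' ⊆ K := by
  obtain ⟨x, -, hx, -⟩ := hN.infinite.inter_nonempty_of_finite_diff hfin hfin
  exact exists_isComponent hK'.conn.1 (fun y hy => ⟨hS' (hK'.subset hy).1,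
    fun h => (hK'.subset hy).2 ⟨h, (hK'.subset hy).1⟩⟩) ⟨x, hx⟩

theorem exists_finset_inter (X : Finset α) (S' : Set α) :
    ∃ Y : Finset α, (Y : Set α) = (X : Set α) ∩ S' :=
  ⟨(X.finite_toSet.inter_of_left S').toFinset, Set.Finite.coe_toFinset _⟩

theorem necklaceEquiv_of_induce {N N' : Set α} (hN : (M.induce S' hS').IsNecklace N)
    (hN' : (M.induce S' hS').IsNecklace N') (h : (M.induce S' hS').NecklaceEquiv N N') :
    M.NecklaceEquiv N N' := by
  rw [necklaceEquiv_iff hN hN'] at h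
  rw [necklaceEquiv_iff (isNecklace_induce.1 hN).1 (isNecklace_induce.1 hN').1]
  intro X _
  obtain ⟨Y, hY⟩ := exists_finset_inter X S'
  obtain ⟨K', hK', h1, h2⟩ := h Y (by rw [hY]; exact Set.inter_subset_right)
  rw [hY] at hK'
  obtain ⟨K, hK, hKK⟩ := exists_component_of_induce hN hK' h1
  exact ⟨K, hK, h1.subset (Set.sdiff_subset_sdiff_right hKK),
    h2.subset (Set.sdiff_subset_sdiff_right hKK)⟩

theorem exists_end_of_induce (ω' : (M.induce S' hS').End) :
    ∃ ω : M.End, ω'.necklaces ⊆ ω.necklaces := by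
  obtain ⟨N, hN⟩ := ω'.nonempty
  have hN' := isNecklace_induce.1 (End.isNecklace hN)
  refine ⟨M.endOf N hN'.1, fun N₁ hN₁ => ?_⟩
  exact ⟨(isNecklace_induce.1 (End.isNecklace hN₁)).1,
    necklaceEquiv_of_induce (End.isNecklace hN) (End.isNecklace hN₁) ((End.mem_iff hN).1 hN₁).2⟩

/-- The end of the whole connectoid that contains an end of an induced subconnectoid. -/
noncomputable def inducedEndMap (M : Connectoid α) (S' : Set α) (hS' : S' ⊆ M.ground)
    (ω' : (M.induce S' hS').End) : M.End := (exists_end_of_induce ω').choose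

theorem necklaces_subset_inducedEndMap (ω' : (M.induce S' hS').End) :
    ω'.necklaces ⊆ (M.inducedEndMap S' hS' ω').necklaces :=
  (exists_end_of_induce ω').choose_spec

theorem necklaces_subset_iff (ω' : (M.induce S' hS').End) (ω : M.End) :
    ω'.necklaces ⊆ ω.necklaces ↔ ω = M.inducedEndMap S' hS' ω' := by
  constructor
  · intro h
    obtain ⟨N, hN⟩ := ω'.nonempty
    exact End.eq_of_mem (h hN) (necklaces_subset_inducedEndMap ω' hN)
  · rintro rfl
    exact necklaces_subset_inducedEndMap ω'

/-- A component `K'` of `S' \ X` is connected in `M` and avoids `X`, so all ends living in `K'` are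
sent into one component of the complement of `X`. -/
theorem continuous_inducedEndMap : Continuous (M.inducedEndMap S' hS') := by
  refine continuous_generateFrom_iff.2 ?_
  rintro _ ⟨X, K, hX, hK, rfl⟩
  rw [isOpen_iff_forall_mem_open]
  intro ω' hω'
  obtain ⟨Y, hY⟩ := exists_finset_inter X S'
  have hYS : (Y : Set α) ⊆ (M.induce S' hS').ground := by
    rw [hY]
    exact Set.inter_subset_right
  obtain ⟨K', hK'⟩ := exists_isEndComponent hYS ω'
  have hincl : ∀ η : (M.induce S' hS').End, (M.induce S' hS').IsEndComponent Y η K' →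
      ∃ L, M.IsComponent (M.ground \ X) L ∧ K' ⊆ L ∧
        M.IsEndComponent X (M.inducedEndMap S' hS' η) L := by
    intro η hη
    obtain ⟨N, hN⟩ := η.nonempty
    have hfin := (isEndComponent_iff hYS hN).1 hη
    obtain ⟨L, hL, hKL⟩ :=
      exists_component_of_induce (X := X) (End.isNecklace hN) (hY ▸ hfin.1) hfin.2
    exact ⟨L, hL, hKL, (isEndComponent_iff hX (necklaces_subset_inducedEndMap η hN)).2
      ⟨hL, hfin.2.subset (Set.sdiff_subset_sdiff_right hKL)⟩⟩
  obtain ⟨N, hN⟩ := ω'.nonempty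
  obtain ⟨x, -, hxK', -⟩ := (End.isNecklace hN).infinite.inter_nonempty_of_finite_diff
    ((isEndComponent_iff hYS hN).1 hK').2 ((isEndComponent_iff hYS hN).1 hK').2
  obtain ⟨L, hL, hKL, hωL⟩ := hincl ω' hK'
  have hLK : L = K := by
    obtain ⟨N₁, hN₁⟩ := (M.inducedEndMap S' hS' ω').nonempty
    exact (End.isNecklace hN₁).component_unique hL hK ((isEndComponent_iff hX hN₁).1 hωL).2
      ((isEndComponent_iff hX hN₁).1 hω').2
  refine ⟨_, fun η hη => ?_, isOpen_isEndComponent hYS hK'.1, hK'⟩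
  obtain ⟨L', hL', hKL', hηL'⟩ := hincl η hη
  have : L' = K := hLK ▸ hL'.eq_of_inter hL ⟨x, hKL' hxK', hKL hxK'⟩
  exact this ▸ hηL'

end Induce

/-! ### Deleting a maximal family of disjoint necklaces -/

section Maximal

variable {Γ : Set M.End} {𝒩 : Set (Set α)}

theorem exists_maximal_isDisjointNecklaceFamily (Δ : Set M.End) :
    ∃ 𝒩 : Set (Set α), Maximal (M.IsDisjointNecklaceFamily Δ) 𝒩 := by
  obtain ⟨𝒩, h𝒩⟩ := zorn_subset {𝒩 | M.IsDisjointNecklaceFamily Δ 𝒩} (by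
    intro c hc hchain
    refine ⟨⋃₀ c, ⟨?_, ?_⟩, fun s hs => Set.subset_sUnion_of_mem hs⟩
    · rintro N ⟨𝒩, h𝒩, hN⟩
      exact (hc h𝒩).1 N hN
    · exact (Set.pairwiseDisjoint_sUnion hchain.directedOn).2 fun 𝒩 h𝒩 => (hc h𝒩).2)
  exact ⟨𝒩, h𝒩⟩

/-- Each end in an open set has a neighbourhood that avoids a disjoint family of necklaces outside
that open set. -/
theorem exists_component_disjoint (hΓ : IsOpen Γ) (h𝒩 : M.IsDisjointNecklaceFamily Γᶜ 𝒩)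
    {ω : M.End} (hω : ω ∈ Γ) :
    ∃ (X : Finset α) (K : Set α), (X : Set α) ⊆ M.ground ∧ M.IsEndComponent X ω K ∧
      K ⊆ M.ground \ ⋃₀ 𝒩 := by
  classical
  obtain ⟨X, K, hX, hK, hsub⟩ := exists_basic_subset hΓ hω
  have hnot : ∀ N ∈ 𝒩, M.IsNecklace N ∧ ¬ (N \ K).Finite := by
    intro N hN
    obtain ⟨η, hη, hNη⟩ := h𝒩.1 N hN
    exact ⟨End.isNecklace hNη,
      fun hfin => hη (hsub ((isEndComponent_iff hX hNη).2 ⟨hK.1, hfin⟩))⟩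
  -- A necklace meeting `K` but not `X` would be contained in `K`.
  have hmeet : ∀ N ∈ {N ∈ 𝒩 | (N ∩ K).Nonempty}, (N ∩ X).Nonempty := by
    rintro N ⟨hN, hNK⟩
    by_contra hemp
    refine (hnot N hN).2 ?_
    rw [Set.not_nonempty_iff_eq_empty, ← Set.disjoint_iff_inter_eq_empty] at hemp
    rw [Set.sdiff_eq_empty.2 (hK.1.subset_of_inter (hnot N hN).1.1
      (Set.subset_sdiff.2 ⟨(hnot N hN).1.subset_ground, hemp⟩) hNK)]
    exact Set.finite_empty
  have hfin𝒩 : {N ∈ 𝒩 | (N ∩ K).Nonempty}.Finite := by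
    obtain ⟨N₀, hN₀⟩ := ω.nonempty
    obtain ⟨x₀, -⟩ := (End.isNecklace hN₀).infinite.nonempty
    have : Nonempty α := ⟨x₀⟩
    choose! f hf using hmeet
    refine Set.Finite.of_injOn (f := f) (fun N hN => (hf N hN).2) ?_ X.finite_toSet
    intro N hN N' hN' hNN'
    exact h𝒩.2.elim hN.1 hN'.1
      (Set.not_disjoint_iff.2 ⟨f N, (hf N hN).1, hNN' ▸ (hf N' hN').1⟩)
  have hfin : (K ∩ ⋃₀ 𝒩).Finite := by
    refine (hfin𝒩.biUnion (t := fun N => N ∩ K) fun N hN => ?_).subset ?_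
    -- Almost all of `N` lies in a component `L` other than `K`.
    · obtain ⟨L, hL, hNL⟩ := (hnot N hN.1).1.exists_component X.finite_toSet
      refine hNL.subset fun x hx => ⟨hx.1, fun hxL => (hnot N hN.1).2 ?_⟩
      rwa [hK.1.eq_of_inter hL ⟨x, hx.2, hxL⟩]
    · rintro x ⟨hxK, N, hN, hxN⟩
      exact Set.mem_biUnion (show N ∈ {N ∈ 𝒩 | (N ∩ K).Nonempty} from ⟨hN, x, hxN, hxK⟩)
        ⟨hxN, hxK⟩
  have hY : ((X ∪ hfin.toFinset : Finset α) : Set α) ⊆ M.ground := by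
    rw [Finset.coe_union, Set.Finite.coe_toFinset]
    exact Set.union_subset hX (Set.inter_subset_left.trans (Connectoid.subset_ground hK.1.conn))
  obtain ⟨J, hJ⟩ := exists_isEndComponent hY ω
  have hJK := hK.subset_of_subset hY Finset.subset_union_left hJ
  refine ⟨_, J, hY, hJ, fun x hx => ⟨Connectoid.subset_ground hJ.1.conn hx, fun hxU => ?_⟩⟩
  refine (hJ.1.subset hx).2 ?_
  rw [Finset.coe_union, Set.Finite.coe_toFinset]
  exact Or.inr ⟨hJK hx, hxU⟩

/-- A neighbourhood of an end that lies in `S'` can be chosen to avoid any finite set. -/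
theorem exists_component_subset_of_induce {S' : Set α} {hS' : S' ⊆ M.ground} {X X' : Finset α}
    {K : Set α} {ω : M.End} (hX : (X : Set α) ⊆ M.ground) (hK : M.IsEndComponent X ω K)
    (hKS : K ⊆ S') (hX' : (X' : Set α) ⊆ S') :
    ∃ (Y : Finset α) (J K' : Set α), (Y : Set α) ⊆ M.ground ∧ M.IsEndComponent Y ω J ∧
      (M.induce S' hS').IsComponent (S' \ (X' : Set α)) K' ∧ J ⊆ K' := by
  classical
  have hY : ((X ∪ X' : Finset α) : Set α) ⊆ M.ground := by
    rw [Finset.coe_union]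
    exact Set.union_subset hX (hX'.trans hS')
  obtain ⟨J, hJ⟩ := exists_isEndComponent hY ω
  have hJS := (hK.subset_of_subset hY Finset.subset_union_left hJ).trans hKS
  obtain ⟨N, hN⟩ := ω.nonempty
  have hfin := ((isEndComponent_iff hY hN).1 hJ).2
  obtain ⟨x, -, hx, -⟩ := (End.isNecklace hN).infinite.inter_nonempty_of_finite_diff hfin hfin
  obtain ⟨K', hK', hJK'⟩ := exists_isComponent (M := M.induce S' hS') (A := S' \ (X' : Set α))
    (show J ∈ M.conn ∩ 𝒫 S' from ⟨hJ.1.conn, hJS⟩)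
    (fun y hy => ⟨hJS hy, fun h => (hJ.1.subset hy).2 (by
      rw [Finset.coe_union]
      exact Or.inr h)⟩) ⟨x, hx⟩
  exact ⟨_, J, K', hY, hJ, hK', hJK'⟩

/-- Otherwise a necklace of `ω'`, disjoint from all of `𝒩`, could be added to `𝒩`. -/
theorem inducedEndMap_mem (h𝒩 : Maximal (M.IsDisjointNecklaceFamily Γᶜ) 𝒩)
    (ω' : (M.induce (M.ground \ ⋃₀ 𝒩) Set.sdiff_subset).End) :
    M.inducedEndMap _ Set.sdiff_subset ω' ∈ Γ := by
  by_contra hω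
  obtain ⟨N, hN⟩ := ω'.nonempty
  have hN' := isNecklace_induce.1 (End.isNecklace hN)
  have hdisj : ∀ N' ∈ 𝒩, Disjoint N N' := fun N' h => Set.disjoint_left.2 fun x hx hx' =>
    (hN'.2 hx).2 ⟨N', h, hx'⟩
  have hfam : M.IsDisjointNecklaceFamily Γᶜ (insert N 𝒩) := by
    refine ⟨?_, h𝒩.prop.2.insert fun N' h _ => hdisj N' h⟩
    rintro N₁ (rfl | h)
    · exact ⟨_, hω, necklaces_subset_inducedEndMap ω' hN⟩
    · exact h𝒩.prop.1 N₁ h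
  have hmem : N ∈ 𝒩 := h𝒩.le_of_ge hfam (Set.subset_insert _ _) (Set.mem_insert _ _)
  obtain ⟨x, hx⟩ := hN'.1.infinite.nonempty
  exact Set.disjoint_left.1 (hdisj N hmem) hx hx

/-- Near an end of `Γ` small components lie in `S'`, so necklaces equivalent in `M` share them and
cannot be separated in `S'`. -/
theorem inducedEndMap_injective (hΓ : IsOpen Γ)
    (h𝒩 : Maximal (M.IsDisjointNecklaceFamily Γᶜ) 𝒩) :
    Function.Injective (M.inducedEndMap (M.ground \ ⋃₀ 𝒩) Set.sdiff_subset) := by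
  intro ω' η' heq
  obtain ⟨N, hN⟩ := ω'.nonempty
  obtain ⟨N', hN'⟩ := η'.nonempty
  have hNω := necklaces_subset_inducedEndMap ω' hN
  have hNη := necklaces_subset_inducedEndMap η' hN'
  rw [← heq] at hNη
  obtain ⟨X, K, hX, hK, hKS⟩ := exists_component_disjoint hΓ h𝒩.prop (inducedEndMap_mem h𝒩 ω')
  refine End.eq_of_mem hN ((End.mem_iff hN').2 ⟨End.isNecklace hN, ?_⟩)
  rw [necklaceEquiv_iff (End.isNecklace hN') (End.isNecklace hN)]
  intro X' hX'
  obtain ⟨Y, J, K', hY, hJ, hK', hJK'⟩ :=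
    exists_component_subset_of_induce (hS' := Set.sdiff_subset) hX hK hKS hX'
  exact ⟨K', hK',
    ((isEndComponent_iff hY hNη).1 hJ).2.subset (Set.sdiff_subset_sdiff_right hJK'),
    ((isEndComponent_iff hY hNω).1 hJ).2.subset (Set.sdiff_subset_sdiff_right hJK')⟩

theorem exists_inducedEndMap_eq (hΓ : IsOpen Γ) (h𝒩 : M.IsDisjointNecklaceFamily Γᶜ 𝒩)
    {ω : M.End} (hω : ω ∈ Γ) :
    ∃ ω', M.inducedEndMap (M.ground \ ⋃₀ 𝒩) Set.sdiff_subset ω' = ω := by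
  obtain ⟨X, K, hX, hK, hKS⟩ := exists_component_disjoint hΓ h𝒩 hω
  obtain ⟨N, hN⟩ := ω.nonempty
  have hNK := ((isEndComponent_iff hX hN).1 hK).2
  -- Removing the finite set `N \ K` leaves an equivalent necklace inside `K`, hence inside `S'`.
  obtain ⟨T, hT, hTN, hfin⟩ := (End.isNecklace hN).exists_necklace_diff hNK
  have hTK : T ⊆ K := fun x hx => by_contra fun h => (hTN hx).2 ⟨(hTN hx).1, h⟩
  have hT' : (M.induce (M.ground \ ⋃₀ 𝒩) Set.sdiff_subset).IsNecklace T :=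
    isNecklace_induce.2 ⟨hT, hTK.trans hKS⟩
  refine ⟨endOf _ T hT', End.eq_of_mem (necklaces_subset_inducedEndMap _ (mem_endOf hT')) ?_⟩
  exact (End.mem_iff hN).2 ⟨hT, necklaceEquiv_of_finite_diff (End.isNecklace hN) hT (by
    rw [Set.sdiff_eq_empty.2 (hTN.trans Set.sdiff_subset)]
    exact Set.finite_empty)⟩

theorem isOpenMap_inducedEndMap (hΓ : IsOpen Γ)
    (h𝒩 : Maximal (M.IsDisjointNecklaceFamily Γᶜ) 𝒩) :
    IsOpenMap (M.inducedEndMap (M.ground \ ⋃₀ 𝒩) Set.sdiff_subset) := by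
  intro U hU
  rw [isOpen_iff_forall_mem_open]
  rintro _ ⟨ω', hω', rfl⟩
  have hωΓ := inducedEndMap_mem h𝒩 ω'
  obtain ⟨X', L, hX', hL, hLU⟩ := exists_basic_subset hU hω'
  obtain ⟨X, K, hX, hK, hKS⟩ := exists_component_disjoint hΓ h𝒩.prop hωΓ
  obtain ⟨Y, J, K', hY, hJ, hK', hJK'⟩ :=
    exists_component_subset_of_induce (hS' := Set.sdiff_subset) hX hK hKS hX'
  have hmem : ∀ η', M.IsEndComponent Y (M.inducedEndMap _ Set.sdiff_subset η') J →
      (M.induce (M.ground \ ⋃₀ 𝒩) Set.sdiff_subset).IsEndComponent X' η' K' := by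
    intro η' hη'
    obtain ⟨N, hN⟩ := η'.nonempty
    exact (isEndComponent_iff hX' hN).2 ⟨hK',
      ((isEndComponent_iff hY (necklaces_subset_inducedEndMap η' hN)).1 hη').2.subset
        (Set.sdiff_subset_sdiff_right hJK')⟩
  have hKL : K' = L := by
    obtain ⟨N, hN⟩ := ω'.nonempty
    exact (End.isNecklace hN).component_unique hK' hL.1
      ((isEndComponent_iff hX' hN).1 (hmem ω' hJ)).2 ((isEndComponent_iff hX' hN).1 hL).2
  -- Intersecting with `Γ` provides preimages, which are known to exist only over `Γ`.
  refine ⟨{ω | M.IsEndComponent Y ω J} ∩ Γ, ?_, (isOpen_isEndComponent hY hJ.1).inter hΓ,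
    hJ, hωΓ⟩
  rintro η ⟨hη, hηΓ⟩
  obtain ⟨η', rfl⟩ := exists_inducedEndMap_eq hΓ h𝒩.prop hηΓ
  exact ⟨η', hLU (hKL ▸ hmem η' hη), rfl⟩

/-- The end space of the subconnectoid obtained by deleting a maximal family of disjoint necklaces
outside the open set `Γ` is homeomorphic to `Γ`. -/
noncomputable def inducedEndHomeomorph (hΓ : IsOpen Γ)
    (h𝒩 : Maximal (M.IsDisjointNecklaceFamily Γᶜ) 𝒩) :
    (M.induce (M.ground \ ⋃₀ 𝒩) Set.sdiff_subset).End ≃ₜ Γ :=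
  (Equiv.ofBijective
    (fun ω' => (⟨M.inducedEndMap _ Set.sdiff_subset ω', inducedEndMap_mem h𝒩 ω'⟩ : Γ))
    ⟨fun _ _ h => inducedEndMap_injective hΓ h𝒩 (congrArg Subtype.val h), fun ω => by
      obtain ⟨ω', h⟩ := exists_inducedEndMap_eq hΓ h𝒩.prop ω.2
      exact ⟨ω', Subtype.ext h⟩⟩).toHomeomorphOfContinuousOpen
  (continuous_inducedEndMap.subtype_mk _)
  ((isOpenMap_inducedEndMap hΓ h𝒩).subtype_mk _)

end Maximal

end Connectoid

theorem mainTheorem8 {α : Type u} (M : Connectoid α) (Γ : Set M.End) (hΓ : IsOpen Γ) :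
    (∃ 𝒩 : Set (Set α), Maximal (M.IsDisjointNecklaceFamily Γᶜ) 𝒩) ∧
    (∀ 𝒩 : Set (Set α), Maximal (M.IsDisjointNecklaceFamily Γᶜ) 𝒩 →
      ∃ φ : (M.induce (M.ground \ ⋃₀ 𝒩) Set.sdiff_subset).End ≃ₜ Γ,
        ∀ (ω' : (M.induce (M.ground \ ⋃₀ 𝒩) Set.sdiff_subset).End) (ω : M.End),
          ω'.necklaces ⊆ ω.necklaces ↔ ω = φ ω') ∧
    UltraParacompact Γ := by
  obtain ⟨𝒩, h𝒩⟩ := Connectoid.exists_maximal_isDisjointNecklaceFamily Γᶜ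
  exact ⟨⟨𝒩, h𝒩⟩, fun 𝒩 h𝒩 => ⟨Connectoid.inducedEndHomeomorph hΓ h𝒩, fun ω' ω =>
    Connectoid.necklaces_subset_iff ω' ω⟩,
    (Connectoid.ultraParacompact_end _).of_homeomorph (Connectoid.inducedEndHomeomorph hΓ h𝒩)⟩
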